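/- All groups are abelian. A *rank-1 group* is a torsion-free group of rank one. A *type* is an equivalence class of sequences $(t_p)_{p\in\Pi}$, indexed by the set $\Pi$ of all primes, with $t_p\in\mathbb{N}\cup\{\infty\}$ (where $0\in\mathbb{N}$); two sequences are equivalent if they differ in only finitely many entries and both are finite wherever they differ. The type $t(T)$ of a rank-1 group $T$ is the class of the sequence of $p$-heights of any nonzero element of $T$. Types are ordered by $\tau\le\rho$ if they have representatives with $t_p\le r_p$ for all $p$. For a group $T$ let $T^\perp=\{X \mid \mathrm{Ext}(T,X)=0\}$. **Proposition 1.8.** Let $T$ and $R$ be rank-1 groups with types $t(T)=\tau<\rho=t(R)$, represented by sequences $(t_p)_{p\in\Pi}$ and $(r_p)_{p\in\Pi}$, respectively, with $t_p\le r_p$ for all primes $p$. Suppose that * (2b) there is an infinite set $P$ of primes such that $0<t_p<r_p<\infty$ for all $p\in P$, but that neither of the following holds: * (1) there is a prime $q$ with $t_q<\infty$ and $r_q=\infty$; * (2a) there is an infinite set $P$ of primes such that $t_p=0$ and $0\neq r_p<\infty$ for all $p\in P$. Let $\mathcal{F}$ denote the class of all torsion-free groups of finite rank. Then $$T^\perp\cap\mathcal{F}=R^\perp\cap\mathcal{F}.$$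 Moreover, every group $G$ that belongs to exactly one of $T^\perp$ and $R^\perp$ has infinite (torsion-free) rank. -/

import Mathlib

open CategoryTheory

universe u

namespace RationalGroups

/-- The `p`-height of `x`: the supremum in `ℕ ∪ {∞}` of all `n` such that `x ∈ pⁿ G`. -/
noncomputable def pHeight {G : Type u} [AddCommGroup G] (p : ℕ) (x : G) : ℕ∞ :=
  ⨆ n ∈ {n : ℕ | ∃ y : G, p ^ n • y = x}, (n : ℕ∞)

/-- Sequences `(t_p)` indexed by the primes, with entries in `ℕ ∪ {∞}`. -/
abbrev Characteristic : Type := Nat.Primes → ℕ∞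

/-- The characteristic of an element: the sequence of all its `p`-heights. -/
noncomputable def characteristic {G : Type u} [AddCommGroup G] (x : G) : Characteristic :=
  fun p => pHeight (p : ℕ) x

/-- Two sequences are equivalent if they differ in only finitely many entries, and
are both finite wherever they differ. -/
def Characteristic.Equivalent (a b : Characteristic) : Prop :=
  {p | a p ≠ b p}.Finite ∧ ∀ p, a p ≠ b p → a p ≠ ⊤ ∧ b p ≠ ⊤

theorem Characteristic.equivalent_equivalence :
    Equivalence Characteristic.Equivalent where
  refl a := ⟨by simp, fun p h => absurd rfl h⟩
  symm {a b} h := by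
    refine ⟨?_, fun p hp => (h.2 p hp.symm).symm⟩
    simpa only [ne_comm] using h.1
  trans {a b c} h h' := by
    refine ⟨(h.1.union h'.1).subset ?_, ?_⟩
    · intro p hp
      by_cases hab : a p = b p
      · right
        show b p ≠ c p
        rw [← hab]
        exact hp
      · exact Or.inl hab
    · intro p hp
      have h1 := h.2 p
      have h2 := h'.2 p
      grind

instance Characteristic.setoid : Setoid Characteristic :=
  ⟨Characteristic.Equivalent, Characteristic.equivalent_equivalence⟩

/-- A type is an equivalence class of sequences. -/
def GroupType : Type := Quotient Characteristic.setoid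

/-- The type represented by a sequence. -/
def GroupType.mk (a : Characteristic) : GroupType := Quotient.mk Characteristic.setoid a

theorem GroupType.mk_eq_mk {a b : Characteristic} :
    GroupType.mk a = GroupType.mk b ↔ a.Equivalent b :=
  Quotient.eq (r := Characteristic.setoid)

/-- `τ ≤ ρ` if the types have representatives with `t_p ≤ r_p` for all primes `p`;
`τ < ρ` means `τ ≤ ρ` and not `ρ ≤ τ`. -/
instance : PartialOrder GroupType where
  le τ ρ := ∃ t r : Characteristic, GroupType.mk t = τ ∧ GroupType.mk r = ρ ∧ ∀ p, t p ≤ r p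
  le_refl τ := by
    obtain ⟨t, rfl⟩ := Quotient.exists_rep τ
    exact ⟨t, t, rfl, rfl, fun _ => le_rfl⟩
  le_trans := by
    rintro _ _ _ ⟨a, b, rfl, rfl, hab⟩ ⟨b', c, hb, rfl, hbc⟩
    rw [GroupType.mk_eq_mk] at hb
    refine ⟨fun p => min (a p) (c p), c, ?_, rfl, fun p => min_le_right _ _⟩
    rw [GroupType.mk_eq_mk]
    have key : ∀ p, min (a p) (c p) ≠ a p → b' p ≠ b p ∧ c p < a p := by
      intro p hp
      have hca : c p < a p := by
        by_contra hcon
        exact hp (min_eq_left (not_lt.mp hcon))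
      exact ⟨(((hbc p).trans_lt hca).trans_le (hab p)).ne, hca⟩
    refine ⟨hb.1.subset fun p hp => (key p hp).1, fun p hp => ?_⟩
    obtain ⟨h1, h2⟩ := key p hp
    have ha : a p ≠ ⊤ := ne_top_of_le_ne_top (hb.2 p h1).2 (hab p)
    exact ⟨ne_top_of_le_ne_top ha (min_le_left _ _), ha⟩
  le_antisymm := by
    rintro _ _ ⟨a, b, rfl, rfl, hab⟩ ⟨b', a', hb, ha, hba⟩
    rw [GroupType.mk_eq_mk] at hb ha
    rw [GroupType.mk_eq_mk]
    have key : ∀ p, a p ≠ b p → a' p ≠ a p ∨ b' p ≠ b p := by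
      intro p hp
      by_contra! hcon
      have := hba p
      rw [hcon.1, hcon.2] at this
      exact hp (le_antisymm (hab p) this)
    refine ⟨(ha.1.union hb.1).subset fun p hp => key p hp, fun p hp => ?_⟩
    have hlt : a p < b p := lt_of_le_of_ne (hab p) hp
    refine ⟨hlt.ne_top, ?_⟩
    rcases key p hp with h | h
    · intro hbt
      have hb' : b' p = ⊤ := by
        by_contra hne
        exact (hb.2 p (by rw [hbt]; exact hne)).2 hbt
      exact (ha.2 p h).1 (top_le_iff.mp (hb' ▸ hba p))
    · exact (hb.2 p h).2

/-- Rank-1 groups: torsion-free abelian groups of rank one. -/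
structure IsRankOne (T : Type u) [AddCommGroup T] : Prop where
  torsionFree : IsAddTorsionFree T
  rank_eq : Module.rank ℤ T = 1

theorem IsRankOne.exists_ne_zero {T : Type u} [AddCommGroup T] (hT : IsRankOne T) :
    ∃ x : T, x ≠ 0 := by
  by_contra! h
  have : Subsingleton T := ⟨fun a b => by rw [h a, h b]⟩
  have h1 := hT.rank_eq
  rw [rank_subsingleton'] at h1
  exact zero_ne_one h1

/-- The type `t(T)` of a rank-1 group `T`: the class of the characteristic of a nonzero element
(it does not depend on the element, see `typeOf_eq`). -/
noncomputable def typeOf (T : Type u) [AddCommGroup T] (hT : IsRankOne T) : GroupType :=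
  GroupType.mk (characteristic (Classical.choose hT.exists_ne_zero))

theorem pow_dvd_of_le_pHeight {G : Type u} [AddCommGroup G] {p n : ℕ} {x : G}
    (h : (n : ℕ∞) ≤ pHeight p x) : ∃ y : G, p ^ n • y = x := by
  by_contra hn
  rcases Nat.eq_zero_or_pos n with rfl | hpos
  · exact hn ⟨x, by simp⟩
  have : pHeight p x ≤ ((n - 1 : ℕ) : ℕ∞) := by
    refine iSup₂_le fun m ⟨y, hy⟩ => ?_
    have : m < n := by
      by_contra hmn
      refine hn ⟨p ^ (m - n) • y, ?_⟩
      rw [smul_smul, ← pow_add, Nat.add_sub_cancel' (not_lt.mp hmn), hy]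
    exact_mod_cast Nat.le_sub_one_of_lt this
  have := h.trans this
  have : n ≤ n - 1 := by exact_mod_cast this
  omega

theorem le_pHeight {G : Type u} [AddCommGroup G] {p n : ℕ} {x : G}
    (h : ∃ y : G, p ^ n • y = x) : (n : ℕ∞) ≤ pHeight p x :=
  le_iSup₂ (f := fun (n : ℕ) (_ : n ∈ {n : ℕ | ∃ y : G, p ^ n • y = x}) => (n : ℕ∞)) n h

theorem characteristic_smul_equivalent {G : Type u} [AddCommGroup G] [IsAddTorsionFree G]
    (x : G) {m : ℤ} (hm : m ≠ 0) :
    (characteristic (m • x)).Equivalent (characteristic x) := by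
  have hle : ∀ p : Nat.Primes, pHeight (p : ℕ) x ≤ pHeight (p : ℕ) (m • x) := by
    intro p
    refine iSup₂_le fun n ⟨y, hy⟩ => le_pHeight ⟨m • y, ?_⟩
    rw [smul_comm, hy]
  have hge : ∀ p : Nat.Primes, ∀ v : ℕ, ∀ m' : ℤ, m = (p : ℤ) ^ v * m' → ¬ (p : ℤ) ∣ m' →
      pHeight (p : ℕ) (m • x) ≤ pHeight (p : ℕ) x + v := by
    intro p v m' hmm hpm
    refine iSup₂_le fun n ⟨y, hy⟩ => ?_
    rcases le_total n v with hnv | hnv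
    · exact le_trans (by exact_mod_cast hnv) le_add_self
    · obtain ⟨k, rfl⟩ := Nat.exists_eq_add_of_le hnv
      have hp0 : ((p : ℕ) : ℕ) ^ v ≠ 0 := pow_ne_zero _ p.2.ne_zero
      have h1 : (p : ℕ) ^ k • y = m' • x := by
        apply IsAddTorsionFree.nsmul_right_injective hp0
        show (p : ℕ) ^ v • ((p : ℕ) ^ k • y) = (p : ℕ) ^ v • (m' • x)
        rw [smul_smul, ← pow_add, hy, hmm, mul_smul, ← natCast_zsmul (m' • x)]
        push_cast
        rfl
      have hcop : IsCoprime ((p : ℤ) ^ k) m' :=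
        ((Nat.prime_iff_prime_int.mp p.2).coprime_iff_not_dvd.mpr hpm).pow_left
      obtain ⟨a, b, hab⟩ := hcop
      have h2 : ∃ z : G, (p : ℕ) ^ k • z = x := by
        refine ⟨a • x + b • y, ?_⟩
        have h3 : ((p : ℤ) ^ k) • y = m' • x := by
          rw [← h1, ← natCast_zsmul]
          push_cast
          rfl
        rw [← natCast_zsmul]
        push_cast
        rw [smul_add, smul_comm _ b y, h3, smul_smul, smul_smul, ← add_smul, mul_comm, hab,
          one_smul]
      have h4 := le_pHeight h2
      push_cast
      rw [add_comm]
      gcongr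
  have hfac : ∀ p : Nat.Primes, ∃ (v : ℕ) (m' : ℤ), m = (p : ℤ) ^ v * m' ∧ ¬ (p : ℤ) ∣ m' := by
    intro p
    have hfin : FiniteMultiplicity (p : ℤ) m := by
      refine Int.finiteMultiplicity_iff.mpr ⟨?_, hm⟩
      simpa using p.2.ne_one
    obtain ⟨c, hc, hd⟩ := hfin.exists_eq_pow_mul_and_not_dvd
    exact ⟨_, c, hc, hd⟩
  refine ⟨?_, fun p hp => ?_⟩
  · have hfin : {p : Nat.Primes | (p : ℕ) ∣ m.natAbs}.Finite := by
      refine Set.Finite.of_finite_image (f := fun p : Nat.Primes => (p : ℕ)) ?_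
        Subtype.val_injective.injOn
      refine (Finset.finite_toSet (Nat.divisors m.natAbs)).subset ?_
      rintro _ ⟨p, hp, rfl⟩
      simpa [hm] using hp
    refine hfin.subset fun p hp => ?_
    by_contra hdvd
    refine hp (le_antisymm ?_ (hle p))
    have := hge p 0 m (by simp) (fun h => hdvd (Int.natCast_dvd.mp h))
    rw [Nat.cast_zero, add_zero] at this
    exact this
  · obtain ⟨v, m', h1, h2⟩ := hfac p
    have hg := hge p v m' h1 h2
    have hx : pHeight (p : ℕ) x ≠ ⊤ := by
      intro htop
      have := hle p
      rw [htop, top_le_iff] at this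
      exact hp (this.trans htop.symm)
    refine ⟨ne_top_of_le_ne_top ?_ hg, hx⟩
    simp [hx]

theorem typeOf_eq {T : Type u} [AddCommGroup T] (hT : IsRankOne T) {x : T} (hx : x ≠ 0) :
    typeOf T hT = GroupType.mk (characteristic x) := by
  have := hT.torsionFree
  have hy := Classical.choose_spec hT.exists_ne_zero
  unfold typeOf
  set y := Classical.choose hT.exists_ne_zero
  have hdep : ¬ LinearIndependent ℤ ![x, y] := by
    intro h
    have h1 := h.cardinal_lift_le_rank
    rw [hT.rank_eq] at h1
    simp at h1
  rw [LinearIndependent.pair_iff] at hdep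
  push Not at hdep
  obtain ⟨m, n, hmn, hne⟩ := hdep
  have hm : m ≠ 0 := by
    rintro rfl
    have : n • y = 0 := by simpa using hmn
    rcases smul_eq_zero.mp this with h | h
    · exact hne rfl h
    · exact hy h
  have hn : n ≠ 0 := by
    rintro rfl
    have : m • x = 0 := by simpa using hmn
    rcases smul_eq_zero.mp this with h | h
    · exact hm h
    · exact hx h
  have heq : m • x = (-n) • y := by
    rw [neg_smul]
    exact eq_neg_of_add_eq_zero_left hmn
  have e1 := GroupType.mk_eq_mk.mpr (characteristic_smul_equivalent x hm)
  have e2 := GroupType.mk_eq_mk.mpr (characteristic_smul_equivalent y (neg_ne_zero.mpr hn))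
  rw [← e1, heq, e2]

/-- `T^⊥`: the class of all abelian groups `X` with `Ext(T, X) = 0`. -/
def perp (T : ModuleCat.{u} ℤ) : Set (ModuleCat.{u} ℤ) :=
  {X | Subsingleton (Abelian.Ext T X 1)}

/-- The class of all torsion-free abelian groups of finite rank. -/
def finiteRankTorsionFree : Set (ModuleCat.{u} ℤ) :=
  {G | IsAddTorsionFree G ∧ Module.rank ℤ G < Cardinal.aleph0}

end RationalGroups

/-!
By Baer's theorem a rank-1 group of type `[t]` is isomorphic to the group `A t` of all rational
numbers whose denominators are bounded by `t`. Let `G` be a group with `Ext(A t, G) = 0`. Lifting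
homomorphisms from `A t / ℤ` along the cokernel of an embedding of `G` into an injective group shows
that the map from `G` to the product of the groups `G / pG`, over the primes `p` with `t p ≠ 0`, is
surjective. If `G` has finite rank, it is countable modulo torsion, so `G = pG` for almost all of
these `p`. If `t ≤ r` have the same infinite entries and almost the same zero entries, then after a
change of `t` at finitely many primes every element of `A r / A t` is annihilated by some `n` with
`G = nG`. Such torsion groups satisfy `Ext(A r / A t, G) = 0`, since the part of `G` killed by
numbers of this kind is injective, and therefore `Ext(A r, G) = 0`.
-/

namespace RationalGroups

universe v w

section Ext

variable {C : Type u} [Category.{v} C] [Abelian C] [HasExt.{w} C]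

theorem subsingleton_ext_one_iff_forall_exists_lift {S : ShortComplex C} (hS : S.ShortExact)
    [Injective S.X₂] (X : C) :
    Subsingleton (Abelian.Ext X S.X₁ 1) ↔ ∀ φ : X ⟶ S.X₃, ∃ ψ : X ⟶ S.X₂, ψ ≫ S.g = φ := by
  constructor
  · intro hX φ
    obtain ⟨x, hx⟩ := Abelian.Ext.covariant_sequence_exact₃ X hS (Abelian.Ext.mk₀ φ) (zero_add 1)
      (Subsingleton.elim _ _)
    obtain ⟨ψ, rfl⟩ := (Abelian.Ext.mk₀_bijective X S.X₂).2 x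
    rw [Abelian.Ext.mk₀_comp_mk₀] at hx
    exact ⟨ψ, (Abelian.Ext.mk₀_bijective X S.X₃).1 hx⟩
  · refine fun hX => subsingleton_of_forall_eq 0 fun e => ?_
    obtain ⟨x, rfl⟩ := Abelian.Ext.covariant_sequence_exact₁ X hS (n₁ := 1) e
      (Abelian.Ext.eq_zero_of_injective _) (zero_add 1)
    obtain ⟨φ, rfl⟩ := (Abelian.Ext.mk₀_bijective X S.X₃).2 x
    obtain ⟨ψ, rfl⟩ := hX φ
    rw [← Abelian.Ext.mk₀_comp_mk₀, Abelian.Ext.comp_assoc_of_second_deg_zero, hS.comp_extClass,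
      Abelian.Ext.comp_zero]

end Ext

section Lifting

variable {A : Type*} [CommRing A] {T R G D Q : Type*} [AddCommGroup T] [Module A T]
  [AddCommGroup R] [Module A R] [AddCommGroup G] [Module A G] [AddCommGroup D] [Module A D]
  [AddCommGroup Q] [Module A Q]

/-- Every homomorphism `T → Q` lifts along `q : D → Q`. If `q` is the cokernel of an embedding of
`G` into an injective group, this says that `Ext(T, G) = 0`. -/
def LiftsAlong (T : Type*) [AddCommGroup T] [Module A T] (q : D →ₗ[A] Q) : Prop :=
  ∀ φ : T →ₗ[A] Q, ∃ ψ : T →ₗ[A] D, q ∘ₗ ψ = φ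

/-- The sequence `0 → G → D → Q → 0` is exact and `D` is an injective module. Injectivity is
encoded by Baer's criterion, which does not refer to universes. -/
structure IsInjectivePresentation (i : G →ₗ[A] D) (q : D →ₗ[A] Q) : Prop where
  injective : Function.Injective i
  exact : Function.Exact i q
  surjective : Function.Surjective q
  baer : Module.Baer A D

theorem LiftsAlong.of_injective {q : D →ₗ[A] Q} (hR : LiftsAlong R q) (hQ : Module.Baer A Q)
    {f : T →ₗ[A] R} (hf : Function.Injective f) : LiftsAlong T q := by
  intro φ
  obtain ⟨φ', rfl⟩ := hQ.extension_property f hf φ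
  obtain ⟨ψ, rfl⟩ := hR φ'
  exact ⟨ψ ∘ₗ f, rfl⟩

theorem LiftsAlong.of_quotient_range {q : D →ₗ[A] Q} {f : T →ₗ[A] R} (hT : LiftsAlong T q)
    (hRT : LiftsAlong (R ⧸ f.range) q) (hD : Module.Baer A D) (hf : Function.Injective f) :
    LiftsAlong R q := by
  intro φ
  obtain ⟨ψ, hψ⟩ := hT (φ ∘ₗ f)
  obtain ⟨ψ', rfl⟩ := hD.extension_property f hf ψ
  have hker : f.range ≤ (φ - q ∘ₗ ψ').ker := by
    rw [LinearMap.range_le_ker_iff, LinearMap.sub_comp, LinearMap.comp_assoc, hψ, sub_self]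
  obtain ⟨θ, hθ⟩ := hRT (f.range.liftQ _ hker)
  refine ⟨θ ∘ₗ f.range.mkQ + ψ', ?_⟩
  rw [LinearMap.comp_add, ← LinearMap.comp_assoc, hθ, Submodule.liftQ_mkQ, sub_add_cancel]

theorem exists_comp_eq_of_ker_le {M : Type*} [AddCommGroup M] [Module A M] (hQ : Module.Baer A Q)
    {f : M →ₗ[A] T} {g : M →ₗ[A] Q} (h : f.ker ≤ g.ker) : ∃ φ : T →ₗ[A] Q, φ ∘ₗ f = g := by
  have hf : Function.Injective (f.ker.liftQ f le_rfl) :=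
    LinearMap.ker_eq_bot.mp (Submodule.ker_liftQ_eq_bot _ _ _ le_rfl)
  obtain ⟨φ, hφ⟩ := hQ.extension_property _ hf (f.ker.liftQ g h)
  exact ⟨φ, by rw [← f.ker.liftQ_mkQ f le_rfl, ← LinearMap.comp_assoc, hφ, Submodule.liftQ_mkQ]⟩

theorem smul_eq_zero_of_linearCombination_eq_zero {ι : Type*} {a : ι → A} {w : ι → T}
    (ha : Pairwise (Function.onFun IsCoprime a)) (hw : ∀ j, a j • w j = 0) {c : ι →₀ A}
    (hc : Finsupp.linearCombination A w c = 0) (j : ι) : c j • w j = 0 := by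
  classical
  have hind : iSupIndep fun k => Submodule.torsionBy A T (a k) :=
    iSupIndep_iff_supIndep.mpr fun _ => Submodule.supIndep_torsionBy (ha.set_pairwise _)
  have hmem (k : ι) : c k • w k ∈ Submodule.torsionBy A T (a k) := by
    rw [Submodule.mem_torsionBy_iff, smul_comm, hw, smul_zero]
  by_cases hj : j ∈ c.support
  · exact iSupIndep_iff_finsetSum_eq_zero_imp_eq_zero _ |>.mp hind c.support _
      (fun k _ => hmem k) hc j hj
  · rw [Finsupp.notMem_support_iff.mp hj, zero_smul]

/-- Elements with pairwise coprime annihilators are independent, so their images in an injective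
module may be prescribed one by one. -/
theorem exists_linearMap_apply_eq {ι : Type*} {a : ι → A} {w : ι → T} {u : ι → Q}
    (hQ : Module.Baer A Q) (ha : Pairwise (Function.onFun IsCoprime a)) (hw : ∀ j, a j • w j = 0)
    (hu : ∀ j (c : A), c • w j = 0 → c • u j = 0) : ∃ φ : T →ₗ[A] Q, ∀ j, φ (w j) = u j := by
  obtain ⟨φ, hφ⟩ := exists_comp_eq_of_ker_le hQ (f := Finsupp.linearCombination A w)
    (g := Finsupp.linearCombination A u) fun c hc => Finset.sum_eq_zero fun j _ =>
      hu j (c j) (smul_eq_zero_of_linearCombination_eq_zero ha hw hc j)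
  exact ⟨φ, fun j => by simpa using LinearMap.congr_fun hφ (Finsupp.single j 1)⟩

end Lifting

theorem exists_isInjectivePresentation {A : Type w} [CommRing A] [Small.{u} A]
    (G : ModuleCat.{u} A) :
    ∃ (D Q : ModuleCat.{u} A) (i : G →ₗ[A] D) (q : D →ₗ[A] Q), IsInjectivePresentation i q ∧
      ∀ T : ModuleCat.{u} A, Subsingleton (Abelian.Ext T G 1) ↔ LiftsAlong T q := by
  let S := ShortComplex.mk (Injective.ι G) (Limits.cokernel.π (Injective.ι G)) (by simp)
  have hS : S.ShortExact :=
    { exact := ShortComplex.exact_of_g_is_cokernel _ (Limits.cokernelIsCokernel _) }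
  have : Injective S.X₂ := Injective.injective_under G
  refine ⟨S.X₂, S.X₃, S.f.hom, S.g.hom, ?_, fun T => ?_⟩
  · exact
      { injective := hS.moduleCat_injective_f
        exact := (ShortComplex.ShortExact.moduleCat_exact_iff_function_exact S).mp hS.exact
        surjective := hS.moduleCat_surjective_g
        baer := Module.Baer.of_injective ((Module.injective_iff_injective_object A S.X₂).mpr this) }
  · refine (subsingleton_ext_one_iff_forall_exists_lift hS T).trans
      ⟨fun h φ => ?_, fun h φ => ?_⟩
    · obtain ⟨ψ, hψ⟩ := h (ModuleCat.ofHom φ)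
      exact ⟨ψ.hom, congrArg ModuleCat.Hom.hom hψ⟩
    · obtain ⟨ψ, hψ⟩ := h φ.hom
      exact ⟨ModuleCat.ofHom ψ, ModuleCat.hom_ext hψ⟩

theorem exists_eq_of_int (M : ModuleCat.{u} ℤ) :
    ∃ (X : Type u) (_ : AddCommGroup X), M = ModuleCat.of ℤ X := by
  obtain @⟨X, _, inst⟩ := M
  obtain rfl : inst = AddCommGroup.toIntModule X := Subsingleton.elim _ _
  exact ⟨X, _, rfl⟩

theorem exists_isInjectivePresentation_int (G : Type u) [AddCommGroup G] :
    ∃ (D Q : Type u) (_ : AddCommGroup D) (_ : AddCommGroup Q) (i : G →ₗ[ℤ] D) (q : D →ₗ[ℤ] Q),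
      IsInjectivePresentation i q ∧ ∀ (T : Type u) [AddCommGroup T],
        ModuleCat.of ℤ G ∈ perp (ModuleCat.of ℤ T) ↔ LiftsAlong T q := by
  obtain ⟨D, Q, i, q, h, hperp⟩ := exists_isInjectivePresentation (ModuleCat.of ℤ G)
  obtain ⟨D, _, rfl⟩ := exists_eq_of_int D
  obtain ⟨Q, _, rfl⟩ := exists_eq_of_int Q
  exact ⟨D, Q, _, _, i, q, h, fun T _ => hperp (ModuleCat.of ℤ T)⟩

/-- The natural numbers by which the group `G` is divisible. -/
def divisorMonoid (G : Type*) [AddCommGroup G] : Submonoid ℕ where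
  carrier := {n | Function.Surjective fun g : G => n • g}
  one_mem' := fun g => ⟨g, one_smul ℕ g⟩
  mul_mem' := fun {m n} hm hn => by
    simpa only [Set.mem_ofPred_eq, Function.comp_def, mul_smul] using hm.comp hn

section Divisibility

variable {G : Type*} [AddCommGroup G]

theorem mem_divisorMonoid_of_dvd {m n : ℕ} (hn : n ∈ divisorMonoid G) (hmn : m ∣ n) :
    m ∈ divisorMonoid G := by
  obtain ⟨k, rfl⟩ := hmn
  intro g
  obtain ⟨h, rfl⟩ := hn g
  exact ⟨k • h, (mul_smul m k h).symm⟩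

theorem exists_smul_eq_of_smul_eq_smul {n : ℕ} {m : ℤ} (hnm : IsCoprime (n : ℤ) m) {x y : G}
    (h : n • y = m • x) : ∃ z : G, n • z = x := by
  obtain ⟨u, v, huv⟩ := hnm
  refine ⟨u • x + v • y, ?_⟩
  calc n • (u • x + v • y) = u • n • x + v • n • y := by
        rw [smul_add, smul_comm n u, smul_comm n v]
    _ = (u * n + v * m) • x := by rw [h, add_smul, mul_smul, mul_smul, natCast_zsmul]
    _ = x := by rw [huv, one_smul]

theorem mem_divisorMonoid_of_baer (hG : Module.Baer ℤ G) {n : ℕ} (hn : n ≠ 0) :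
    n ∈ divisorMonoid G := by
  intro g
  obtain ⟨φ, hφ⟩ := hG.extension_property (LinearMap.lsmul ℤ ℤ n)
    (LinearMap.lsmul_injective (Nat.cast_ne_zero.mpr hn)) (LinearMap.toSpanSingleton ℤ G g)
  refine ⟨φ 1, ?_⟩
  simpa [← map_nsmul] using LinearMap.congr_fun hφ 1

theorem baer_of_forall_prime_mem_divisorMonoid (hG : ∀ p : ℕ, p.Prime → p ∈ divisorMonoid G) :
    Module.Baer ℤ G := by
  have hmem : ∀ {n : ℕ}, n ≠ 0 → n ∈ divisorMonoid G := fun {n} hn => by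
    rw [← Nat.prod_primeFactorsList hn]
    exact list_prod_mem fun p hp => hG p (Nat.prime_of_mem_primeFactorsList hp)
  let _ : DivisibleBy G ℕ := divisibleByOfSMulRightSurj G ℕ hmem
  let _ : DivisibleBy G ℤ := AddGroup.divisibleByIntOfDivisibleByNat G
  exact Module.Baer.of_divisible G

theorem prime_mem_divisorMonoid_torsion' {p : ℕ} (hp : p.Prime) :
    p ∈ divisorMonoid (Submodule.torsion' ℤ G (divisorMonoid G)) := by
  rintro ⟨g, n, hng⟩
  have hng : (n : ℕ) • g = 0 := hng
  by_cases hpG : p ∈ divisorMonoid G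
  · obtain ⟨h, rfl⟩ := hpG g
    refine ⟨⟨h, n * ⟨p, hpG⟩, ?_⟩, rfl⟩
    change ((n : ℕ) * p) • h = 0
    rw [mul_smul, hng]
  · have hpn : IsCoprime (p : ℤ) ((n : ℕ) : ℤ) := Nat.isCoprime_iff_coprime.mpr
      (hp.coprime_iff_not_dvd.mpr fun h => hpG (mem_divisorMonoid_of_dvd n.2 h))
    refine exists_smul_eq_of_smul_eq_smul hpn (y := 0) (Subtype.ext ?_)
    rw [smul_zero, natCast_zsmul]
    exact hng.symm

end Divisibility

namespace IsInjectivePresentation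

variable {G D Q T R : Type*} [AddCommGroup G] [AddCommGroup D] [AddCommGroup Q] [AddCommGroup T]
  [AddCommGroup R] {i : G →ₗ[ℤ] D} {q : D →ₗ[ℤ] Q}

theorem baer_quotient (h : IsInjectivePresentation i q) : Module.Baer ℤ Q := by
  refine baer_of_forall_prime_mem_divisorMonoid fun p hp x => ?_
  obtain ⟨d, rfl⟩ := h.surjective x
  obtain ⟨e, rfl⟩ := mem_divisorMonoid_of_baer h.baer hp.ne_zero d
  exact ⟨q e, (map_nsmul q p e).symm⟩

/-- The torsion of `G` with respect to the numbers dividing `G` is injective, which splits off the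
corresponding torsion of `D`. -/
theorem exists_section_torsion' (h : IsInjectivePresentation i q) :
    ∃ s : Submodule.torsion' ℤ Q (divisorMonoid G) →ₗ[ℤ] D, ∀ x, q (s x) = x := by
  let N := divisorMonoid G
  have hi : ∀ g ∈ Submodule.torsion' ℤ G N, i g ∈ Submodule.torsion' ℤ D N :=
    fun g ⟨n, hn⟩ => ⟨n, (map_nsmul i n g).symm.trans ((congrArg i hn).trans (map_zero i))⟩
  have hq : ∀ d ∈ Submodule.torsion' ℤ D N, q d ∈ Submodule.torsion' ℤ Q N :=
    fun d ⟨n, hn⟩ => ⟨n, (map_nsmul q n d).symm.trans ((congrArg q hn).trans (map_zero q))⟩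
  have hinj : Function.Injective (i.restrict hi) :=
    fun _ _ hgg => Subtype.ext (h.injective (congrArg Subtype.val hgg))
  have hexact : Function.Exact (i.restrict hi) (q.restrict hq) := by
    rintro ⟨d, n, hn⟩
    refine Subtype.ext_iff.trans ((h.exact d).trans ⟨?_, ?_⟩)
    · rintro ⟨g, rfl⟩
      exact ⟨⟨g, n, h.injective (((map_nsmul i n g).trans hn).trans (map_zero i).symm)⟩, rfl⟩
    · rintro ⟨g, hg⟩
      exact ⟨g, congrArg Subtype.val hg⟩
  have hsurj : Function.Surjective (q.restrict hq) := by
    rintro ⟨x, n, hn⟩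
    obtain ⟨d, rfl⟩ := h.surjective x
    obtain ⟨g, hg⟩ := (h.exact ((n : ℕ) • d)).mp ((map_nsmul q (n : ℕ) d).trans hn)
    obtain ⟨g', rfl⟩ := n.2 g
    refine ⟨⟨d - i g', n, ?_⟩, Subtype.ext ?_⟩
    · change (n : ℕ) • (d - i g') = 0
      rw [smul_sub, ← map_nsmul, hg, sub_self]
    · change q (d - i g') = q d
      rw [map_sub, h.exact.apply_apply_eq_zero, sub_zero]
  have hbaer : Module.Baer ℤ (Submodule.torsion' ℤ G N) :=
    baer_of_forall_prime_mem_divisorMonoid fun p hp => prime_mem_divisorMonoid_torsion' hp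
  obtain ⟨l, hl⟩ := hbaer.extension_property (i.restrict hi) hinj LinearMap.id
  have hsplit : (∃ s, q.restrict hq ∘ₗ s = LinearMap.id) ↔
      ∃ l, l ∘ₗ i.restrict hi = LinearMap.id := (hexact.split_tfae hinj hsurj).out 0 1
  obtain ⟨s, hs⟩ := hsplit.mpr ⟨l, hl⟩
  exact ⟨Submodule.subtype _ ∘ₗ s, fun x => congrArg Subtype.val (LinearMap.congr_fun hs x)⟩

theorem liftsAlong_of_torsion (h : IsInjectivePresentation i q)
    (hT : ∀ a : T, ∃ n ∈ divisorMonoid G, n • a = 0) : LiftsAlong T q := by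
  intro φ
  have hφ : ∀ a, φ a ∈ Submodule.torsion' ℤ Q (divisorMonoid G) := fun a => by
    obtain ⟨n, hn, ha⟩ := hT a
    exact ⟨⟨n, hn⟩, (map_nsmul φ n a).symm.trans ((congrArg φ ha).trans (map_zero φ))⟩
  obtain ⟨s, hs⟩ := h.exists_section_torsion'
  refine ⟨s ∘ₗ φ.codRestrict _ hφ, LinearMap.ext fun a => ?_⟩
  exact hs (φ.codRestrict _ hφ a)

theorem liftsAlong_of_injective (h : IsInjectivePresentation i q) (hT : LiftsAlong T q)
    {f : T →ₗ[ℤ] R} (hf : Function.Injective f)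
    (hfR : ∀ b : R, ∃ n ∈ divisorMonoid G, n • b ∈ f.range) : LiftsAlong R q := by
  refine hT.of_quotient_range (h.liftsAlong_of_torsion fun x => ?_) h.baer hf
  obtain ⟨b, rfl⟩ := f.range.mkQ_surjective x
  obtain ⟨n, hn, hnb⟩ := hfR b
  exact ⟨n, hn, (map_nsmul f.range.mkQ n b).symm.trans
    ((Submodule.Quotient.mk_eq_zero f.range).mpr hnb)⟩

end IsInjectivePresentation

namespace IsInjectivePresentation

variable {G D Q T : Type*} [AddCommGroup G] [AddCommGroup D] [AddCommGroup Q] [AddCommGroup T]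
  [IsAddTorsionFree T] {i : G →ₗ[ℤ] D} {q : D →ₗ[ℤ] Q}

/-- The elements `z j` generate cyclic groups of order `n j` in `T / ℤx`. The congruences are solved
by lifting a homomorphism `T / ℤx → Q` that encodes the right-hand sides `g j`. -/
theorem exists_simultaneous_congruence (h : IsInjectivePresentation i q) (hT : LiftsAlong T q)
    {x : T} (hx : x ≠ 0) {ι : Type*} {n : ι → ℕ}
    (hn : Pairwise (Function.onFun Nat.Coprime n)) {z : ι → T} (hz : ∀ j, n j • z j = x)
    (g : ι → G) : ∃ g₀ : G, ∀ j, ∃ k : G, n j • k = g₀ - g j := by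
  have hn₀ (j : ι) : n j ≠ 0 := fun hj => hx (by rw [← hz j, hj, zero_smul])
  choose d hd using fun j => mem_divisorMonoid_of_baer h.baer (hn₀ j) (i (g j))
  have hqd (j : ι) : n j • q (d j) = 0 := by
    rw [← map_nsmul, ← h.exact.apply_apply_eq_zero (g j)]
    exact congrArg q (hd j)
  let π := (Submodule.span ℤ {x}).mkQ
  have hπx : π x = 0 := (Submodule.Quotient.mk_eq_zero _).mpr (Submodule.mem_span_singleton_self x)
  obtain ⟨φ, hφ⟩ : ∃ φ : (T ⧸ Submodule.span ℤ {x}) →ₗ[ℤ] Q, ∀ j, φ (π (z j)) = q (d j) := by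
    refine exists_linearMap_apply_eq (a := fun j => (n j : ℤ)) h.baer_quotient
      (fun j k hjk => Nat.isCoprime_iff_coprime.mpr (hn hjk)) (fun j => ?_) fun j c hc => ?_
    · rw [natCast_zsmul, ← map_nsmul, hz, hπx]
    · rw [← map_zsmul] at hc
      obtain ⟨m, hm⟩ := Submodule.mem_span_singleton.mp ((Submodule.Quotient.mk_eq_zero _).mp hc)
      have hcm : c = m * n j := by
        refine smul_left_injective ℤ hx ?_
        calc c • x = n j • c • z j := by rw [smul_comm, hz]
          _ = (m * n j) • x := by rw [← hm, mul_comm, mul_smul, natCast_zsmul]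
      rw [hcm, mul_smul, natCast_zsmul, hqd, smul_zero]
  obtain ⟨ψ, hψ⟩ := hT (φ ∘ₗ π)
  have hqψ (a : T) : q (ψ a) = φ (π a) := LinearMap.congr_fun hψ a
  obtain ⟨g₀, hg₀⟩ := (h.exact (ψ x)).mp (by rw [hqψ, hπx, map_zero])
  refine ⟨g₀, fun j => ?_⟩
  obtain ⟨k, hk⟩ := (h.exact (ψ (z j) - d j)).mp (by rw [map_sub, hqψ, hφ, sub_self])
  refine ⟨k, h.injective ?_⟩
  calc i (n j • k) = ψ (n j • z j) - n j • d j := by rw [map_nsmul, hk, smul_sub, map_nsmul]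
    _ = i (g₀ - g j) := by rw [hz, map_sub, hg₀, ← hd]

end IsInjectivePresentation

theorem countable_quotient_torsion {A M : Type*} [CommRing A] [IsDomain A] [Countable A]
    [AddCommGroup M] [Module A M] (hM : Module.rank A M < Cardinal.aleph0) :
    Countable (M ⧸ Submodule.torsion A M) := by
  let V := LocalizedModule (nonZeroDivisors A) M
  let f : M →ₗ[A] V := LocalizedModule.mkLinearMap (nonZeroDivisors A) M
  have hV : Module.rank (FractionRing A) V < Cardinal.aleph0 := by
    rw [IsLocalization.rank_eq (FractionRing A) (nonZeroDivisors A) le_rfl,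
      ← Cardinal.lift_lt_aleph0, IsLocalizedModule.lift_rank_eq (nonZeroDivisors A) f le_rfl]
    exact Cardinal.lift_lt_aleph0.mpr hM
  have : Module.Finite (FractionRing A) V := Module.rank_lt_aleph0_iff.mp hV
  have : Countable (FractionRing A) := by
    rw [← Cardinal.mk_le_aleph0_iff, Cardinal.mk_fractionRing]
    exact Cardinal.mk_le_aleph0
  obtain ⟨n, g, hg⟩ := Module.Finite.exists_fin' (FractionRing A) V
  have : Countable V := hg.countable
  have hker : f.ker = Submodule.torsion A M := Submodule.ext fun m =>
    IsLocalizedModule.eq_zero_iff (nonZeroDivisors A) f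
  rw [← hker]
  exact (LinearMap.ker_eq_bot.mp (f.ker.ker_liftQ_eq_bot f le_rfl le_rfl)).countable

/-- Cantor's diagonal argument: the right-hand side at the prime with index `(c, j)` is chosen such
that no solution lies in the class `c` modulo torsion, unless its torsion part has order divisible
by that prime. -/
theorem finite_of_simultaneous_congruence {G : Type*} [AddCommGroup G]
    (hG : Countable (G ⧸ Submodule.torsion ℤ G)) {S : Set Nat.Primes}
    (hS : ∀ p ∈ S, (p : ℕ) ∉ divisorMonoid G)
    (hsolve : ∀ g : S → G, ∃ g₀ : G, ∀ p : S, ∃ k : G, ((p : Nat.Primes) : ℕ) • k = g₀ - g p) :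
    S.Finite := by
  by_contra hinf
  have : Infinite S := Set.infinite_coe_iff.mpr hinf
  obtain ⟨e⟩ : Nonempty (S ≃ (G ⧸ Submodule.torsion ℤ G) × ℕ) := inferInstance
  choose b hb using fun p : S => not_forall.mp (hS p p.2)
  obtain ⟨g₀, hg₀⟩ := hsolve fun p => (e p).1.out - b p
  let c : G ⧸ Submodule.torsion ℤ G := Submodule.Quotient.mk g₀
  obtain ⟨⟨n, hn⟩, hnc⟩ : g₀ - c.out ∈ Submodule.torsion ℤ G :=
    (Submodule.Quotient.eq _).mp (Submodule.Quotient.mk_out c).symm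
  obtain ⟨j, hj⟩ : ∃ j, ¬ ((e.symm (c, j) : Nat.Primes) : ℕ) ∣ n.natAbs := by
    have hinj : Function.Injective fun j => ((e.symm (c, j) : Nat.Primes) : ℕ) :=
      Subtype.val_injective.comp (Subtype.val_injective.comp
        (e.symm.injective.comp (Prod.mk_right_injective c)))
    obtain ⟨_, ⟨j, rfl⟩, hj⟩ :=
      (Set.infinite_range_of_injective hinj).exists_notMem_finset n.natAbs.divisors
    exact ⟨j, fun hdvd => hj (Nat.mem_divisors.mpr
      ⟨hdvd, Int.natAbs_ne_zero.mpr (nonZeroDivisors.ne_zero hn)⟩)⟩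
  have hcop : IsCoprime (((e.symm (c, j) : Nat.Primes) : ℕ) : ℤ) n :=
    (Nat.prime_iff_prime_int.mp (e.symm (c, j) : Nat.Primes).2).coprime_iff_not_dvd.mpr
      (mt Int.natCast_dvd.mp hj)
  obtain ⟨t, ht⟩ := exists_smul_eq_of_smul_eq_smul hcop ((smul_zero _).trans hnc.symm)
  obtain ⟨k, hk⟩ := hg₀ (e.symm (c, j))
  refine hb (e.symm (c, j)) ⟨k - t, ?_⟩
  simp only [smul_sub, hk, ht, Equiv.apply_symm_apply]
  abel

theorem IsInjectivePresentation.finite_setOf_notMem_divisorMonoid {G D Q T : Type*}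
    [AddCommGroup G] [AddCommGroup D] [AddCommGroup Q] [AddCommGroup T] [IsAddTorsionFree T]
    {i : G →ₗ[ℤ] D} {q : D →ₗ[ℤ] Q} (h : IsInjectivePresentation i q) (hT : LiftsAlong T q)
    (hG : Module.rank ℤ G < Cardinal.aleph0) {x : T} (hx : x ≠ 0) :
    {p : Nat.Primes | (p : ℕ) ∉ divisorMonoid G ∧ ∃ z : T, (p : ℕ) • z = x}.Finite := by
  refine finite_of_simultaneous_congruence (countable_quotient_torsion hG) (fun p hp => hp.1)
    fun g => ?_
  choose z hz using
    fun p : {p : Nat.Primes | (p : ℕ) ∉ divisorMonoid G ∧ ∃ z : T, (p : ℕ) • z = x} => p.2.2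
  exact h.exists_simultaneous_congruence hT hx (fun p r hpr => (Nat.coprime_primes p.1.2 r.1.2).mpr
    fun hval => hpr (Subtype.ext (Subtype.ext hval))) hz g

section Height

variable {G : Type u} [AddCommGroup G] {x : G}

theorem exists_smul_eq_iff_factorization_le_characteristic {n : ℕ} (hn : n ≠ 0) :
    (∃ y : G, n • y = x) ↔ ∀ p : Nat.Primes, (n.factorization p : ℕ∞) ≤ characteristic x p := by
  constructor
  · rintro ⟨y, rfl⟩ p
    refine le_pHeight ⟨(n / p ^ n.factorization p) • y, ?_⟩
    rw [smul_smul, Nat.ordProj_mul_ordCompl_eq_self]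
  · induction n using Nat.recOnPosPrimePosCoprime with
    | zero => exact absurd rfl hn
    | one => exact fun _ => ⟨x, one_smul ℕ x⟩
    | prime_pow p k hp _ =>
      intro h
      exact pow_dvd_of_le_pHeight (by simpa [hp.factorization_pow, characteristic] using h ⟨p, hp⟩)
    | coprime a b _ _ hab iha ihb =>
      intro h
      obtain ⟨ha₀, hb₀⟩ := mul_ne_zero_iff.mp hn
      obtain ⟨y, hy⟩ := iha ha₀ fun p => (h p).trans'
        (Nat.cast_le.mpr (Nat.factorization_le_factorization_mul_left hb₀ p))
      obtain ⟨z, hz⟩ := ihb hb₀ fun p => (h p).trans'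
        (Nat.cast_le.mpr (Nat.factorization_le_factorization_mul_right ha₀ p))
      have hyz : a • y = (b : ℤ) • z := by rw [hy, natCast_zsmul, hz]
      obtain ⟨w, rfl⟩ := exists_smul_eq_of_smul_eq_smul (Nat.isCoprime_iff_coprime.mpr hab) hyz
      exact ⟨w, by rw [mul_comm, mul_smul, hz]⟩

end Height

/-- The rational numbers whose denominators are bounded by the sequence `χ`. By Baer's theorem these
groups represent all rank-1 groups up to isomorphism. -/
def rationalGroup (χ : Characteristic) : AddSubgroup ℚ where
  carrier := {a | ∀ p : Nat.Primes, (a.den.factorization p : ℕ∞) ≤ χ p}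
  zero_mem' := by simp
  add_mem' := fun {a b} ha hb p => by
    have hdvd := (Nat.factorization_le_iff_dvd (a + b).den_nz
      (Nat.lcm_ne_zero a.den_nz b.den_nz)).mpr (Rat.add_den_dvd_lcm a b) p
    rw [Nat.factorization_lcm a.den_nz b.den_nz, Finsupp.sup_apply] at hdvd
    rcases le_sup_iff.mp hdvd with hle | hle
    · exact (Nat.cast_le.mpr hle).trans (ha p)
    · exact (Nat.cast_le.mpr hle).trans (hb p)
  neg_mem' := fun {a} ha => by simpa using ha

section RationalGroup

variable {χ χ' : Characteristic}

theorem mem_rationalGroup_iff {a : ℚ} :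
    a ∈ rationalGroup χ ↔ ∀ p : Nat.Primes, (a.den.factorization p : ℕ∞) ≤ χ p :=
  Iff.rfl

theorem rationalGroup_mono (h : ∀ p, χ p ≤ χ' p) : rationalGroup χ ≤ rationalGroup χ' :=
  fun _ ha p => (ha p).trans (h p)

theorem factorization_den_nsmul {n : ℕ} (hn : n ≠ 0) (a : ℚ) :
    (n • a).den.factorization = a.den.factorization - n.factorization := by
  have hcop : a.num.natAbs.Coprime a.den := a.reduced
  rw [nsmul_eq_mul, Rat.mul_den, Rat.num_natCast, Rat.den_natCast, one_mul, Int.natAbs_mul,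
    Int.natAbs_natCast, hcop.gcd_mul_right_cancel,
    Nat.factorization_div (Nat.gcd_dvd_right n a.den), Nat.factorization_gcd hn a.den_nz]
  ext p
  simp only [Finsupp.tsub_apply, Finsupp.inf_apply]
  lia

theorem nsmul_mem_rationalGroup_iff {n : ℕ} (hn : n ≠ 0) {a : ℚ} :
    n • a ∈ rationalGroup χ ↔
      ∀ p : Nat.Primes, (a.den.factorization p : ℕ∞) ≤ χ p + n.factorization p := by
  simp only [mem_rationalGroup_iff, factorization_den_nsmul hn, Finsupp.tsub_apply,
    ENat.natCast_sub, tsub_le_iff_right]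

theorem Characteristic.Equivalent.exists_injective (h : χ.Equivalent χ') :
    ∃ f : rationalGroup χ →ₗ[ℤ] rationalGroup χ', Function.Injective f := by
  let n := ∏ p ∈ h.1.toFinset, (p : ℕ) ^ (χ p).toNat
  have hn : n ≠ 0 := Finset.prod_ne_zero_iff.mpr fun p _ => pow_ne_zero _ p.2.ne_zero
  have hmem (a : rationalGroup χ) : n • (a : ℚ) ∈ rationalGroup χ' := by
    refine (nsmul_mem_rationalGroup_iff hn).mpr fun p => (a.2 p).trans ?_
    by_cases hp : χ p = χ' p
    · exact hp.le.trans le_self_add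
    · have hdvd : (p : ℕ) ^ (χ p).toNat ∣ n := Finset.dvd_prod_of_mem _ (h.1.mem_toFinset.mpr hp)
      rw [← ENat.natCast_toNat (h.2 p hp).1]
      exact le_add_left (Nat.cast_le.mpr ((p.2.pow_dvd_iff_le_factorization hn).mp hdvd))
  refine ⟨(((nsmulAddMonoidHom n).comp (rationalGroup χ).subtype).codRestrict _
    hmem).toIntLinearMap, fun a b hab => ?_⟩
  exact Subtype.ext (nsmul_right_injective hn (congrArg Subtype.val hab))

theorem exists_nsmul_mem_rationalGroup (N : Submonoid ℕ)
    (hN : ∀ p : Nat.Primes, χ p ≠ χ' p → (p : ℕ) ∈ N) {a : ℚ} (ha : a ∈ rationalGroup χ') :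
    ∃ n ∈ N, n • a ∈ rationalGroup χ := by
  classical
  let f := a.den.factorization.filter (· ∈ N)
  let n := f.prod fun p k => p ^ k
  have hf : ∀ p ∈ f.support, p.Prime ∧ p ∈ N := fun p hp =>
    (Finset.mem_filter.mp hp).imp_left Nat.prime_of_mem_primeFactors
  have hn : n ≠ 0 := Finset.prod_ne_zero_iff.mpr fun p hp => pow_ne_zero _ (hf p hp).1.ne_zero
  have hnf : n.factorization = f := Nat.prod_pow_factorization_eq_self fun p hp => (hf p hp).1
  refine ⟨n, SubmonoidClass.finsuppProd_mem N f _ fun p hp =>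
    pow_mem (hf p (Finsupp.mem_support_iff.mpr hp)).2 _, ?_⟩
  refine (nsmul_mem_rationalGroup_iff hn).mpr fun p => ?_
  rw [hnf]
  by_cases hpN : (p : ℕ) ∈ N
  · rw [Finsupp.filter_apply_pos _ _ hpN]
    exact le_add_self
  · rw [not_imp_comm.mp (hN p) hpN]
    exact (ha p).trans le_self_add

end RationalGroup

section Baer

variable {T : Type u} [AddCommGroup T] {x : T}

theorem IsRankOne.exists_injective_rat (hT : IsRankOne T) (hx : x ≠ 0) :
    ∃ f : T →ₗ[ℤ] ℚ, Function.Injective f ∧ f x = 1 := by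
  have := hT.torsionFree
  have hbaer : Module.Baer ℤ ℚ := Module.Baer.of_divisible ℚ
  obtain ⟨f, hf⟩ := hbaer.extension_property (LinearMap.toSpanSingleton ℤ T x)
    (smul_left_injective ℤ hx) (LinearMap.toSpanSingleton ℤ ℚ 1)
  have hfx : f x = 1 := by simpa using LinearMap.congr_fun hf 1
  refine ⟨f, (injective_iff_map_eq_zero f).mpr fun y hy => ?_, hfx⟩
  have hdep : ¬ LinearIndependent ℤ ![x, y] := fun hli => by
    have hrank := hli.cardinal_lift_le_rank
    rw [hT.rank_eq] at hrank
    simp at hrank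
  obtain ⟨m, n, hmn, hne⟩ : ∃ m n : ℤ, m • x + n • y = 0 ∧ ¬ (m = 0 ∧ n = 0) := by
    simpa [LinearIndependent.pair_iff] using hdep
  obtain rfl : m = 0 := by simpa [hfx, hy] using congrArg f hmn
  rw [zero_smul, zero_add] at hmn
  exact (smul_eq_zero.mp hmn).resolve_left fun hn => hne ⟨rfl, hn⟩

theorem range_eq_rationalGroup_characteristic {f : T →+ ℚ} (hf : Function.Injective f)
    (hfx : f x = 1) : f.range = rationalGroup (characteristic x) := by
  ext a
  rw [mem_rationalGroup_iff, ← exists_smul_eq_iff_factorization_le_characteristic a.den_nz]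
  constructor
  · rintro ⟨y, rfl⟩
    have hcop : IsCoprime ((f y).den : ℤ) (f y).num :=
      (Int.isCoprime_iff_nat_coprime.mpr (f y).reduced).symm
    refine exists_smul_eq_of_smul_eq_smul hcop (y := y) (hf ?_)
    rw [map_nsmul, map_zsmul, hfx, nsmul_eq_mul, zsmul_one, Rat.den_mul_eq_num]
  · rintro ⟨z, hz⟩
    refine ⟨a.num • z, ?_⟩
    have hfz : (a.den : ℚ) * f z = 1 := by rw [← nsmul_eq_mul, ← map_nsmul, hz, hfx]
    rw [map_zsmul, zsmul_eq_mul, ← a.mul_den_eq_num, mul_assoc, hfz, mul_one]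

theorem IsRankOne.nonempty_addEquiv_rationalGroup (hT : IsRankOne T) (hx : x ≠ 0) :
    Nonempty (T ≃+ rationalGroup (characteristic x)) := by
  obtain ⟨f, hf, hfx⟩ := hT.exists_injective_rat hx
  exact ⟨(AddMonoidHom.ofInjective (f := f.toAddMonoidHom) hf).trans (AddEquiv.addSubgroupCongr
    (range_eq_rationalGroup_characteristic hf hfx))⟩

end Baer

theorem Characteristic.Equivalent.liftsAlong_rationalGroup_iff {χ χ' : Characteristic}
    (hχ : χ.Equivalent χ') {D Q : Type*} [AddCommGroup D] [AddCommGroup Q] {q : D →ₗ[ℤ] Q}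
    (hQ : Module.Baer ℤ Q) : LiftsAlong (rationalGroup χ) q ↔ LiftsAlong (rationalGroup χ') q := by
  obtain ⟨f, hf⟩ := hχ.exists_injective
  obtain ⟨f', hf'⟩ := (Characteristic.equivalent_equivalence.symm hχ).exists_injective
  exact ⟨fun h => h.of_injective hQ hf', fun h => h.of_injective hQ hf⟩

theorem IsRankOne.liftsAlong_iff_rationalGroup {T : Type u} [AddCommGroup T] (hT : IsRankOne T)
    {t : Characteristic} (ht : typeOf T hT = GroupType.mk t) {D Q : Type*} [AddCommGroup D]
    [AddCommGroup Q] {q : D →ₗ[ℤ] Q} (hQ : Module.Baer ℤ Q) :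
    LiftsAlong T q ↔ LiftsAlong (rationalGroup t) q := by
  obtain ⟨x, hx⟩ := hT.exists_ne_zero
  obtain ⟨e⟩ := hT.nonempty_addEquiv_rationalGroup hx
  have hiso : LiftsAlong T q ↔ LiftsAlong (rationalGroup (characteristic x)) q :=
    ⟨fun h => h.of_injective hQ e.symm.toIntLinearEquiv.injective,
      fun h => h.of_injective hQ e.toIntLinearEquiv.injective⟩
  exact hiso.trans (Characteristic.Equivalent.liftsAlong_rationalGroup_iff
    (GroupType.mk_eq_mk.mp ((typeOf_eq hT hx).symm.trans ht)) hQ)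

theorem LiftsAlong.rationalGroup_of_le {D Q : Type*} [AddCommGroup D] [AddCommGroup Q]
    {q : D →ₗ[ℤ] Q} (hQ : Module.Baer ℤ Q) {t r : Characteristic} (htr : ∀ p, t p ≤ r p)
    (hR : LiftsAlong (rationalGroup r) q) : LiftsAlong (rationalGroup t) q :=
  hR.of_injective (f := (AddSubgroup.inclusion (rationalGroup_mono htr)).toIntLinearMap) hQ
    (AddSubgroup.inclusion_injective (rationalGroup_mono htr))

theorem Characteristic.equivalent_piecewise {χ χ' : Characteristic} {F : Set Nat.Primes}
    [∀ p, Decidable (p ∈ F)] (hF : F.Finite) (h : ∀ p ∈ F, χ p ≠ ⊤ ∧ χ' p ≠ ⊤) :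
    χ.Equivalent (F.piecewise χ' χ) := by
  have hmem : ∀ p, χ p ≠ F.piecewise χ' χ p → p ∈ F := fun p hp =>
    by_contra fun hpF => hp (F.piecewise_eq_of_notMem χ' χ hpF).symm
  refine ⟨hF.subset hmem, fun p hp => ?_⟩
  rw [F.piecewise_eq_of_mem χ' χ (hmem p hp)]
  exact h p (hmem p hp)

namespace IsInjectivePresentation

variable {G D Q : Type*} [AddCommGroup G] [AddCommGroup D] [AddCommGroup Q] {i : G →ₗ[ℤ] D}
  {q : D →ₗ[ℤ] Q} {t r : Characteristic}

theorem liftsAlong_rationalGroup_of_mem_divisorMonoid (h : IsInjectivePresentation i q)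
    (hT : LiftsAlong (rationalGroup t) q) (htr : ∀ p, t p ≤ r p)
    (hdiv : ∀ p : Nat.Primes, t p ≠ r p → (p : ℕ) ∈ divisorMonoid G) :
    LiftsAlong (rationalGroup r) q := by
  let f := (AddSubgroup.inclusion (rationalGroup_mono htr)).toIntLinearMap
  refine h.liftsAlong_of_injective (f := f) hT
    (AddSubgroup.inclusion_injective (rationalGroup_mono htr)) fun b => ?_
  obtain ⟨n, hn, hnb⟩ := exists_nsmul_mem_rationalGroup _ hdiv b.2
  exact ⟨n, hn, ⟨n • b, hnb⟩, rfl⟩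

theorem finite_setOf_ne_zero_and_notMem_divisorMonoid (h : IsInjectivePresentation i q)
    (hG : Module.rank ℤ G < Cardinal.aleph0) (hT : LiftsAlong (rationalGroup t) q) :
    {p : Nat.Primes | t p ≠ 0 ∧ (p : ℕ) ∉ divisorMonoid G}.Finite := by
  have hone : (1 : ℚ) ∈ rationalGroup t := by simp [mem_rationalGroup_iff]
  have hx : (⟨1, hone⟩ : rationalGroup t) ≠ 0 := fun hx => one_ne_zero (congrArg Subtype.val hx)
  refine (h.finite_setOf_notMem_divisorMonoid hT hG hx).subset fun p hp => ⟨hp.2, ?_⟩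
  have hinv : ((p : ℕ) : ℚ)⁻¹ ∈ rationalGroup t := mem_rationalGroup_iff.mpr fun r => by
    rw [Rat.inv_natCast_den_of_pos p.2.pos, p.2.factorization, Finsupp.single_apply]
    split_ifs with hpr
    · obtain rfl : p = r := Subtype.ext hpr
      exact Order.one_le_iff_ne_zero.mpr hp.1
    · exact zero_le
  refine ⟨⟨_, hinv⟩, Subtype.ext ?_⟩
  exact (nsmul_eq_mul _ _).trans (mul_inv_cancel₀ (Nat.cast_ne_zero.mpr p.2.ne_zero))

theorem liftsAlong_rationalGroup_of_finite (h : IsInjectivePresentation i q)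
    (hG : Module.rank ℤ G < Cardinal.aleph0) (htr : ∀ p, t p ≤ r p)
    (htop : ∀ p, r p = ⊤ → t p = ⊤) (hzero : {p | t p = 0 ∧ r p ≠ 0}.Finite)
    (hT : LiftsAlong (rationalGroup t) q) : LiftsAlong (rationalGroup r) q := by
  classical
  let F : Set Nat.Primes := {p | t p ≠ r p ∧ (p : ℕ) ∉ divisorMonoid G}
  have hF : F.Finite := by
    have hfin := h.finite_setOf_ne_zero_and_notMem_divisorMonoid hG hT
    refine (hzero.union hfin).subset fun p hp => ?_
    by_cases ht : t p = 0
    · exact Or.inl ⟨ht, fun hr => hp.1 (ht.trans hr.symm)⟩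
    · exact Or.inr ⟨ht, hp.2⟩
  have hequiv : t.Equivalent (F.piecewise r t) := Characteristic.equivalent_piecewise hF
    fun p hp => ⟨fun ht => hp.1 (ht.trans (top_le_iff.mp (ht ▸ htr p)).symm),
      fun hr => hp.1 ((htop p hr).trans hr.symm)⟩
  refine h.liftsAlong_rationalGroup_of_mem_divisorMonoid
    ((hequiv.liftsAlong_rationalGroup_iff h.baer_quotient).mp hT)
    (F.piecewise_le (fun _ _ => le_rfl) fun p _ => htr p) fun p hp => ?_
  by_cases hpF : p ∈ F
  · exact absurd (F.piecewise_eq_of_mem r t hpF) hp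
  · rw [F.piecewise_eq_of_notMem r t hpF] at hp
    exact not_not.mp fun hpG => hpF ⟨hp, hpG⟩

end IsInjectivePresentation

theorem mem_perp_iff_of_rank_lt_aleph0 {T R : ModuleCat.{u} ℤ} (hT : IsRankOne T)
    (hR : IsRankOne R) {t r : Characteristic}
    (ht : typeOf T hT = GroupType.mk t) (hr : typeOf R hR = GroupType.mk r)
    (htr : ∀ p, t p ≤ r p) (htop : ∀ p, r p = ⊤ → t p = ⊤)
    (hzero : {p | t p = 0 ∧ r p ≠ 0}.Finite) {G : ModuleCat.{u} ℤ}
    (hG : Module.rank ℤ G < Cardinal.aleph0) : G ∈ perp T ↔ G ∈ perp R := by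
  obtain ⟨T, _, rfl⟩ := exists_eq_of_int T
  obtain ⟨R, _, rfl⟩ := exists_eq_of_int R
  obtain ⟨G, _, rfl⟩ := exists_eq_of_int G
  obtain ⟨D, Q, _, _, i, q, h, hperp⟩ := exists_isInjectivePresentation_int G
  rw [hperp T, hperp R, hT.liftsAlong_iff_rationalGroup ht h.baer_quotient,
    hR.liftsAlong_iff_rationalGroup hr h.baer_quotient]
  exact ⟨h.liftsAlong_rationalGroup_of_finite hG htr htop hzero,
    fun hlift => hlift.rationalGroup_of_le h.baer_quotient htr⟩

end RationalGroups

theorem proposition1p8 (T R : ModuleCat.{u} ℤ)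
    (hT : RationalGroups.IsRankOne T) (hR : RationalGroups.IsRankOne R)
    (t r : RationalGroups.Characteristic)
    (ht : RationalGroups.typeOf T hT = RationalGroups.GroupType.mk t)
    (hr : RationalGroups.typeOf R hR = RationalGroups.GroupType.mk r)
    (htr : ∀ p, t p ≤ r p)
    (hlt : RationalGroups.typeOf T hT < RationalGroups.typeOf R hR)
    (h2b : ∃ P : Set Nat.Primes, P.Infinite ∧ ∀ p ∈ P, 0 < t p ∧ t p < r p ∧ r p < ⊤)
    (h1 : ¬ ∃ q : Nat.Primes, t q < ⊤ ∧ r q = ⊤)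
    (h2a : ¬ ∃ P : Set Nat.Primes, P.Infinite ∧ ∀ p ∈ P, t p = 0 ∧ r p ≠ 0 ∧ r p < ⊤) :
    RationalGroups.perp T ∩ RationalGroups.finiteRankTorsionFree =
        RationalGroups.perp R ∩ RationalGroups.finiteRankTorsionFree ∧
      ∀ G : ModuleCat.{u} ℤ,
        ((G ∈ RationalGroups.perp T ∧ G ∉ RationalGroups.perp R) ∨
          (G ∈ RationalGroups.perp R ∧ G ∉ RationalGroups.perp T)) →
        Cardinal.aleph0 ≤ Module.rank ℤ G := by
  have htop : ∀ p, r p = ⊤ → t p = ⊤ := fun p hp => by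
    by_contra hne
    exact h1 ⟨p, lt_top_iff_ne_top.mpr hne, hp⟩
  have hzero : {p | t p = 0 ∧ r p ≠ 0}.Finite := by
    by_contra hinf
    refine h2a ⟨_, hinf, fun p hp => ⟨hp.1, hp.2, lt_top_iff_ne_top.mpr fun hrp => ?_⟩⟩
    exact ENat.top_ne_zero ((htop p hrp).symm.trans hp.1)
  have hperp : ∀ G : ModuleCat.{u} ℤ, Module.rank ℤ G < Cardinal.aleph0 →
      (G ∈ RationalGroups.perp T ↔ G ∈ RationalGroups.perp R) := fun G hG =>
    RationalGroups.mem_perp_iff_of_rank_lt_aleph0 hT hR ht hr htr htop hzero hG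
  refine ⟨Set.ext fun G => and_congr_left fun hG => hperp G hG.2, fun G hG => ?_⟩
  by_contra hrank
  have := hperp G (not_le.mp hrank)
  tauto
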